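/- Let $E$ be a real Banach space with dual $E^*$ and bidual $E^{**}$, write $\langle\cdot,\cdot\rangle$ for the pairings $E\times E^*\to\mathbb R$ and $E^*\times E^{**}\to\mathbb R$, and let $\widehat{y}\in E^{**}$ be the canonical image of $y\in E$, $\widehat E=\{\widehat y: y\in E\}$. For a multifunction $S:E\rightrightarrows E^*$ let $G(S)=\{(x,x^*): x^*\in Sx\}$ be its graph and $R(S)=\bigcup_{x}Sx$ its range (and likewise for multifunctions $E^*\rightrightarrows E^{**}$). Sums of multifunctions are pointwise Minkowski sums. Call $S$ *closed* if $G(S)$ is norm-closed in $E\times E^*$, *monotone* if $\langle s-t,s^*-t^*\rangle\ge 0$ for all $(s,s^*),(t,t^*)\in G(S)$, and *quasidense* if for all $(x,x^*)\in E\times E^*$ $$\inf_{(s,s^*)\in G(S)}\Big[\tfrac12\|s-x\|^2+\tfrac12\|s^*-x^*\|^2+\langle s-x,s^*-x^*\rangle\Big]\le 0$$ (where $\inf\emptyset=+\infty$). Let $$\varphi_S(x,x^*)=\sup_{(s,s^*)\in G(S)}\big[\langle s,x^*\rangle+\langle x,s^*\rangle-\langle s,s^*\rangle\big]$$ be the Fitzpatrick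 function of $S$ on $E\times E^*$, let $$\varphi_S^*(y^*,y^{**})=\sup_{(x,x^*)\in E\times E^*}\big[\langle x,y^*\rangle+\langle x^*,y^{**}\rangle-\varphi_S(x,x^*)\big]$$ be its conjugate on $E^*\times E^{**}$, and let the Fitzpatrick extension $S^{\mathbb F}:E^*\rightrightarrows E^{**}$ be defined by $y^{**}\in S^{\mathbb F}(y^*)\iff\varphi_S^*(y^*,y^{**})=\langle y^*,y^{**}\rangle$. Let $\operatorname{dom}\varphi_S$ be the set of points at which $\varphi_S$ is finite, and $\pi_2(x,x^*)=x^*$. **Theorem (Sum theorem with range constraints).** Let $S,T:E\rightrightarrows E^*$ be closed, quasidense and monotone. Consider the conditions (a) $R(S)\cap\operatorname{int}R(T)\neq\emptyset$ or $\operatorname{int}R(S)\cap R(T)\neq\emptyset$; (b) $\bigcup_{\lambda>0}\lambda\,[R(S)-R(T)]=E^*$; (c) $\bigcup_{\lambda>0}\lambda\,[\pi_2\operatorname{dom}\varphi_S-\pi_2\operatorname{dom}\varphi_T]$ is a closed linear subspace of $E^*$; (d) the multifunction $E\rightrightarrows E^*$ defined by $y\mapsto(S^{\mathbb F}+T^{\mathbb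 F})^{-1}(\widehat y)$ is closed, quasidense and monotone. Then (a) $\Rightarrow$ (b) $\Rightarrow$ (c) $\Rightarrow$ (d). Moreover: (e) if (d) holds (in particular, if any of (a), (b), (c) holds) and $R(T^{\mathbb F})\subset\widehat E$, then the parallel sum $(S^{-1}+T^{-1})^{-1}:E\rightrightarrows E^*$ is closed, monotone and quasidense. -/

import Mathlib

open scoped Pointwise

noncomputable section

namespace MonotoneSum

/-! Multifunctions `S : X ⇉ Y`, represented as maps `X → Set Y`. -/

/-- The graph `G(S)`. -/
def graph {X Y : Type*} (S : X → Set Y) : Set (X × Y) := {p | p.2 ∈ S p.1}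

/-- The range `R(S) = ⋃ x, S x`. -/
def range {X Y : Type*} (S : X → Set Y) : Set Y := ⋃ x, S x

/-- The inverse multifunction `S⁻¹ : Y ⇉ X`. -/
def inv {X Y : Type*} (S : X → Set Y) : Y → Set X := fun y => {x | y ∈ S x}

/-- The pointwise (Minkowski) sum `(S + T) x = S x + T x`. -/
def sum {X Y : Type*} [Add Y] (S T : X → Set Y) : X → Set Y := fun x => S x + T x

/-- The parallel sum `(S⁻¹ + T⁻¹)⁻¹`. -/
def parallelSum {X Y : Type*} [Add X] (S T : X → Set Y) : X → Set Y :=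
  inv (sum (inv S) (inv T))

variable {E : Type*} [NormedAddCommGroup E] [NormedSpace ℝ E]

/-- `q_L (x, x*) = ⟨x, x*⟩` on `E × E*`. -/
def qL (b : E × StrongDual ℝ E) : ℝ := b.2 b.1

/-- `r_L (x, x*) = ½‖x‖² + ½‖x*‖² + ⟨x, x*⟩` on `E × E*`. -/
def rL (b : E × StrongDual ℝ E) : ℝ :=
  (1 / 2) * ‖b.1‖ ^ 2 + (1 / 2) * ‖b.2‖ ^ 2 + qL b

/-- `S : E ⇉ E*` is closed: its graph is closed in `E × E*` for the norm topology. -/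
def IsClosedGraph (S : E → Set (StrongDual ℝ E)) : Prop := IsClosed (graph S)

/-- `S : E ⇉ E*` is monotone. -/
def IsMonotone (S : E → Set (StrongDual ℝ E)) : Prop :=
  ∀ a ∈ graph S, ∀ b ∈ graph S, 0 ≤ qL (a - b)

/-- `S : E ⇉ E*` is quasidense: for every `c ∈ E × E*`, `inf r_L (G(S) - c) ≤ 0`.  The infimum is
taken in the extended reals, so that it is `+∞` if the graph is empty. -/
def IsQuasidense (S : E → Set (StrongDual ℝ E)) : Prop :=
  ∀ c : E × StrongDual ℝ E, (⨅ a ∈ graph S, ((rL (a - c) : ℝ) : EReal)) ≤ 0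

/-- The Fitzpatrick function
`φ_S (x, x*) = sup_{(s, s*) ∈ G(S)} (⟨s, x*⟩ + ⟨x, s*⟩ - ⟨s, s*⟩)`. -/
def fitzpatrick (S : E → Set (StrongDual ℝ E)) (b : E × StrongDual ℝ E) : EReal :=
  ⨆ a ∈ graph S, ((b.2 a.1 + a.2 b.1 - a.2 a.1 : ℝ) : EReal)

/-- The Fenchel conjugate of `f` on `E × E*`, as a function on `E* × E**` under the pairing
`⟨(x, x*), (y*, y**)⟩ = ⟨x, y*⟩ + ⟨x*, y**⟩`. -/
def conjugate (f : E × StrongDual ℝ E → EReal)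
    (c : StrongDual ℝ E × StrongDual ℝ (StrongDual ℝ E)) : EReal :=
  ⨆ b : E × StrongDual ℝ E, (((c.1 b.1 + c.2 b.2 : ℝ) : EReal) - f b)

/-- The Fitzpatrick extension `S^𝔽 : E* ⇉ E**`, whose graph is the set of `(y*, y**)` with
`φ_S* (y*, y**) = ⟨y*, y**⟩`. -/
def fitzpatrickExt (S : E → Set (StrongDual ℝ E)) :
    StrongDual ℝ E → Set (StrongDual ℝ (StrongDual ℝ E)) :=
  fun y => {z | conjugate (fitzpatrick S) (y, z) = ((z y : ℝ) : EReal)}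

/-- The effective domain: the points at which an extended real-valued function is real. -/
def effDom {X : Type*} (f : X → EReal) : Set X := {x | f x ≠ ⊥ ∧ f x ≠ ⊤}

/-- `⋃_{t > 0} t • (A - B)`. -/
def coneDiff {X : Type*} [AddCommGroup X] [Module ℝ X] (A B : Set X) : Set X :=
  ⋃ (t : ℝ) (_ : 0 < t), t • (A - B)

/-- `C` is a closed linear subspace. -/
def IsClosedSubspace {X : Type*} [AddCommGroup X] [Module ℝ X] [TopologicalSpace X]
    (C : Set X) : Prop :=
  IsClosed C ∧ ∃ V : Submodule ℝ X, (V : Set X) = C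

/-- The multifunction `y ↦ (S^𝔽 + T^𝔽)⁻¹ (ŷ)` from `E` to `E*`, where `ŷ` is the canonical image of
`y` in the bidual. -/
def fitzpatrickParallelSum (S T : E → Set (StrongDual ℝ E)) : E → Set (StrongDual ℝ E) :=
  fun y => inv (sum (fitzpatrickExt S) (fitzpatrickExt T))
    (NormedSpace.inclusionInDoubleDual ℝ E y)

end MonotoneSum

end

open scoped Pointwise

noncomputable section

namespace MonotoneSum

open Filter Topology

/-! Write `q` for the duality pairing. For a quasidense monotone `S`, `φ_S` is convex and lies above
`q` on `E × E*`, and `φ_S*` lies above the pairing on `E* × E**`. Let `h` be the infimal convolution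
of `φ_S` and `φ_T` in the first variable. Under (c), the Attouch–Brezis duality
`exists_conj_split_of_conjLE_episum` writes `h*` as the exact infimal convolution of `φ_S*` and
`φ_T*` in the second variable. So `h*` also lies above the pairing, and `h*(y*, ŷ) = ⟨y, y*⟩` holds
exactly when `ŷ` splits into an element of `S^𝔽 y*` and one of `T^𝔽 y*`. The multifunction in (d) is
therefore the coincidence set of `h*` on `E × E*`.

What remains concerns any convex `h ≥ q` whose conjugate lies above the pairing: this set is closed,
monotone and quasidense. Quasidensity is the hard part. Fenchel–Rockafellar
(`exists_sub_qL_add_rL_le`) gives points with both `h - q` and `r_L(· - c)` small; iterating it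
gives a Cauchy sequence whose limit lies in the coincidence set (`exists_mem_conjCoincidence_near`).
Functions are handled through their epigraphs, and `h` need not be lower semicontinuous. -/

/-- A convex subset of `V × ℝ` (an epigraph) that is bounded above near `0` and lies above `m` at
`0` has a continuous affine minorant with value `m` at `0`. -/
theorem exists_affine_minorant {V : Type*} [NormedAddCommGroup V] [NormedSpace ℝ V]
    {Q : Set (V × ℝ)} (hQ : Convex ℝ Q) {δ C m : ℝ} (hδ : 0 < δ)
    (hC : ∀ v, ‖v‖ < δ → ∃ t ≤ C, (v, t) ∈ Q) (hm : ∀ t, ((0 : V), t) ∈ Q → m ≤ t) :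
    ∃ ζ : StrongDual ℝ V, ∀ p ∈ Q, m + ζ p.1 ≤ p.2 := by
  -- The strict upward closure of `Q` has interior and leaves `(0, m)` outside it, so Hahn–Banach
  -- applies at that point.
  set W : Set (V × ℝ) := {p | ∃ s < p.2, (p.1, s) ∈ Q} with hW
  have hWc : Convex ℝ W := by
    rintro ⟨v, t⟩ ⟨s, hs, hsQ⟩ ⟨v', t'⟩ ⟨s', hs', hsQ'⟩ a b ha hb hab
    refine ⟨a * s + b * s', ?_, hQ hsQ hsQ' ha hb hab⟩
    simp only [Prod.snd_add, Prod.smul_mk, smul_eq_mul] at hs hs' ⊢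
    rcases ha.eq_or_lt with rfl | ha'
    · have : b = 1 := by linarith
      subst this; linarith
    · nlinarith [mul_lt_mul_of_pos_left hs ha', mul_le_mul_of_nonneg_left hs'.le hb]
  have hsub : Metric.ball (0 : V) δ ×ˢ Set.Ioi C ⊆ W := by
    rintro ⟨v, t⟩ ⟨hv, ht⟩
    obtain ⟨s, hs, hsQ⟩ := hC v (by simpa using hv)
    exact ⟨s, lt_of_le_of_lt hs ht, hsQ⟩
  have hint : Metric.ball (0 : V) δ ×ˢ Set.Ioi C ⊆ interior W :=
    interior_maximal hsub (Metric.isOpen_ball.prod isOpen_Ioi)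
  have h0 : ((0 : V), m) ∉ interior W := fun h => by
    obtain ⟨s, hs, hsQ⟩ := interior_subset h
    exact absurd (hm s hsQ) (not_le.2 hs)
  obtain ⟨f, hf⟩ := geometric_hahn_banach_open_point hWc.interior isOpen_interior h0
  set ξ : StrongDual ℝ V := f.comp (ContinuousLinearMap.inl ℝ V ℝ) with hξ
  set τ : ℝ := f (0, 1) with hτ
  have hf' : ∀ v t, f (v, t) = ξ v + τ * t := by
    intro v t
    have : ((v, t) : V × ℝ) = (v, 0) + t • ((0 : V), (1 : ℝ)) := by simp
    rw [this, map_add, map_smul]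
    simp [hξ, hτ, mul_comm]
  have hle : ∀ v t, (v, t) ∈ W → ξ v + τ * t ≤ τ * m := by
    intro v t hvt
    have hcl : (v, t) ∈ closure (interior W) := by
      rw [hWc.closure_interior_eq_closure_of_nonempty_interior
        ⟨(0, C + 1), hint ⟨by simpa using hδ, by simp⟩⟩]
      exact subset_closure hvt
    have : closure (interior W) ⊆ {p | f p ≤ f (0, m)} :=
      closure_minimal (fun p hp => (hf p hp).le)
        (isClosed_le f.continuous continuous_const)
    have h := this hcl
    simp only [Set.mem_ofPred_eq, hf', map_zero, zero_add] at h
    exact h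
  have hτneg : τ < 0 := by
    have h := hf (0, max C m + 1) (hint ⟨by simpa using hδ, by
      simp only [Set.mem_Ioi]; linarith [le_max_left C m]⟩)
    simp only [hf', map_zero, zero_add] at h
    have : m < max C m + 1 := by linarith [le_max_right C m]
    by_contra hcon
    nlinarith [mul_le_mul_of_nonneg_left this.le (not_lt.1 hcon)]
  refine ⟨(-τ)⁻¹ • ξ, ?_⟩
  rintro ⟨v, t⟩ hp
  have key : ξ v + τ * t ≤ τ * m := by
    refine le_of_forall_pos_le_add fun ε hε => ?_
    have := hle v (t + ε / (-τ)) ⟨t, by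
      have : 0 < ε / (-τ) := div_pos hε (by linarith)
      simpa using this, hp⟩
    have h2 : τ * (ε / (-τ)) = -ε := by
      field_simp [hτneg.ne]
    rw [mul_add, h2] at this
    linarith
  have hpos : 0 < -τ := by linarith
  have : (-τ)⁻¹ * ξ v ≤ t - m := by
    rw [inv_mul_le_iff₀ hpos]; linarith
  simp only [smul_apply, smul_eq_mul]
  linarith

/-- The conjugate of `½‖·‖²` is `½‖·‖²`, attained up to `ε`. -/
theorem exists_half_sq_norm_sub_le {V : Type*} [NormedAddCommGroup V] [NormedSpace ℝ V]
    (φ : StrongDual ℝ V) {ε : ℝ} (hε : 0 < ε) :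
    ∃ v, (1 / 2) * ‖φ‖ ^ 2 - ε ≤ φ v - (1 / 2) * ‖v‖ ^ 2 := by
  set η := ε / (‖φ‖ + 1) with hη
  have hN : 0 ≤ ‖φ‖ := norm_nonneg _
  have hηpos : 0 < η := by positivity
  obtain ⟨x, hx1, hx⟩ := φ.exists_lt_apply_of_lt_opNorm (show ‖φ‖ - η < ‖φ‖ by linarith)
  obtain ⟨u, hu1, hu⟩ : ∃ u : V, ‖u‖ < 1 ∧ ‖φ‖ - η < φ u := by
    rcases le_total 0 (φ x) with h | h
    · exact ⟨x, hx1, by rwa [Real.norm_of_nonneg h] at hx⟩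
    · exact ⟨-x, by rwa [norm_neg], by rwa [Real.norm_of_nonpos h, ← map_neg] at hx⟩
  -- The unit-ball vector `u` nearly norms `φ`; scaling it by `‖φ‖` nearly maximises `φ v - ½‖v‖²`.
  refine ⟨‖φ‖ • u, ?_⟩
  rw [map_smul, norm_smul, norm_norm, smul_eq_mul, mul_pow]
  have h1 : ‖φ‖ * η ≤ ε := by
    rw [hη, mul_div_assoc', div_le_iff₀ (by positivity)]; nlinarith
  have h2 : ‖u‖ ^ 2 ≤ 1 := by nlinarith [norm_nonneg u]
  nlinarith [mul_le_mul_of_nonneg_left hu.le hN, mul_le_mul_of_nonneg_left h2 (sq_nonneg ‖φ‖)]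

/-! ### Robinson–Ursescu theorem and attainment of the dual optimum. -/

section RobinsonUrsescu

/-- The image of the ball of radius `N` under the multifunction with graph `R`. -/
def boundedImage {X V : Type*} [NormedAddCommGroup X] (R : Set (X × V)) (N : ℝ) :
    Set V :=
  {v | ∃ x, ‖x‖ ≤ N ∧ (x, v) ∈ R}

theorem boundedImage_mono {X V : Type*} [NormedAddCommGroup X] (R : Set (X × V)) :
    Monotone (boundedImage R) :=
  fun _ _ h _ ⟨x, hx, hR⟩ => ⟨x, hx.trans h, hR⟩

variable {X V : Type*} [NormedAddCommGroup X] [NormedSpace ℝ X]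
  [NormedAddCommGroup V] [NormedSpace ℝ V]

theorem convex_boundedImage {R : Set (X × V)} (hR : Convex ℝ R) (N : ℝ) :
    Convex ℝ (boundedImage R N) := by
  rintro v ⟨x, hx, hxv⟩ v' ⟨x', hx', hxv'⟩ a b ha hb hab
  refine ⟨a • x + b • x', ?_, hR hxv hxv' ha hb hab⟩
  calc ‖a • x + b • x'‖ ≤ ‖a • x‖ + ‖b • x'‖ := norm_add_le _ _
    _ = a * ‖x‖ + b * ‖x'‖ := by
      rw [norm_smul, norm_smul, Real.norm_of_nonneg ha, Real.norm_of_nonneg hb]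
    _ ≤ a * N + b * N := by gcongr
    _ = N := by rw [← add_mul, hab, one_mul]

/-- Successive approximation: the remainder is doubled at each stage and approximated again, and the
solutions are summed with weights `1/2, 1/4, …`. Since the first weight is `1/2`, the process starts
at `2 • v`, which costs half the radius. -/
theorem ball_subset_boundedImage_of_subset_closure [CompleteSpace X] {R : Set (X × V)}
    (hRc : IsClosed R) (hR : Convex ℝ R) {N δ : ℝ} (hδ : 0 < δ)
    (h : Metric.ball 0 δ ⊆ closure (boundedImage R N)) :
    Metric.ball 0 (δ / 2) ⊆ boundedImage R N := by
  intro v hv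
  have hstep : ∀ w : V, ∃ p : X × V, w ∈ Metric.ball (0 : V) δ →
      ‖p.1‖ ≤ N ∧ p ∈ R ∧ ‖w - p.2‖ < δ / 2 := by
    intro w
    by_cases hw : w ∈ Metric.ball (0 : V) δ
    · obtain ⟨b, ⟨x, hx, hxb⟩, hb⟩ := Metric.mem_closure_iff.1 (h hw) (δ / 2) (by positivity)
      exact ⟨(x, b), fun _ => ⟨hx, hxb, by rwa [← dist_eq_norm]⟩⟩
    · exact ⟨0, fun h' => absurd h' hw⟩
  choose p hp using hstep
  let w : ℕ → V := fun n => Nat.rec ((2 : ℝ) • v) (fun _ w => (2 : ℝ) • (w - (p w).2)) n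
  have hw0 : w 0 = (2 : ℝ) • v := rfl
  have hws : ∀ n, w (n + 1) = (2 : ℝ) • (w n - (p (w n)).2) := fun _ => rfl
  have hwb : ∀ n, w n ∈ Metric.ball (0 : V) δ := by
    intro n
    induction n with
    | zero =>
      rw [mem_ball_zero_iff] at hv ⊢
      rw [hw0, norm_smul, Real.norm_of_nonneg (by norm_num)]
      linarith
    | succ n ih =>
      rw [mem_ball_zero_iff, hws, norm_smul, Real.norm_of_nonneg (by norm_num)]
      linarith [(hp _ ih).2.2]
  have hN : 0 ≤ N := (norm_nonneg _).trans (hp _ (hwb 0)).1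
  let s : ℕ → X × V := fun n => ∑ i ∈ Finset.range n, ((1 / 2 : ℝ) ^ (i + 1)) • p (w i)
  have hss : ∀ n, s (n + 1) = s n + ((1 / 2 : ℝ) ^ (n + 1)) • p (w n) :=
    fun n => Finset.sum_range_succ _ _
  -- The weights in `s n` total `1 - 2⁻ⁿ`, so any point of `R` with weight `2⁻ⁿ` completes a convex
  -- combination.
  have hmem : ∀ n, ∀ a ∈ R, s n + ((1 / 2 : ℝ) ^ n) • a ∈ R := by
    intro n
    induction n with
    | zero => intro a ha; simpa [s] using ha
    | succ n ih =>
      intro a ha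
      have := ih _ (hR (hp _ (hwb n)).2.1 ha (a := 1 / 2) (b := 1 / 2) (by norm_num) (by norm_num)
        (by norm_num))
      rw [hss, pow_succ]
      convert this using 1
      module
  have hnorm : ∀ n, ‖(s n).1‖ ≤ N := by
    have : ∀ n, ‖(s n).1‖ ≤ N * (1 - (1 / 2) ^ n) := by
      intro n
      induction n with
      | zero => simp [s]
      | succ n ih =>
        rw [hss]
        calc ‖(s n + ((1 / 2 : ℝ) ^ (n + 1)) • p (w n)).1‖
            ≤ ‖(s n).1‖ + ‖((1 / 2 : ℝ) ^ (n + 1)) • (p (w n)).1‖ := norm_add_le _ _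
          _ ≤ N * (1 - (1 / 2) ^ n) + (1 / 2 : ℝ) ^ (n + 1) * N := by
            rw [norm_smul, Real.norm_of_nonneg (by positivity)]
            gcongr
            exact (hp _ (hwb n)).1
          _ = N * (1 - (1 / 2) ^ (n + 1)) := by ring
    intro n
    have h1 := this n
    have h2 : (0 : ℝ) < (1 / 2) ^ n := by positivity
    nlinarith
  have hrem : ∀ n, v - (s n).2 = ((1 / 2 : ℝ) ^ (n + 1)) • w n := by
    intro n
    induction n with
    | zero => simp [s, hw0, smul_smul]
    | succ n ih =>
      rw [hss, Prod.snd_add, ← sub_sub, ih, hws, Prod.smul_snd, smul_smul, ← smul_sub]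
      congr 1
      ring
  have hcauchy : CauchySeq fun n => (s n).1 := by
    refine cauchySeq_of_le_geometric (1 / 2) N (by norm_num) fun n => ?_
    rw [dist_comm, dist_eq_norm, hss, Prod.fst_add, add_sub_cancel_left, Prod.smul_fst, norm_smul,
      Real.norm_of_nonneg (by positivity), pow_succ]
    have h2 : (0 : ℝ) < (1 / 2) ^ n := by positivity
    nlinarith [mul_le_mul_of_nonneg_left (hp _ (hwb n)).1 h2.le]
  obtain ⟨x, hx⟩ := cauchySeq_tendsto_of_complete hcauchy
  have hpow : Tendsto (fun n : ℕ => (1 / 2 : ℝ) ^ n) atTop (𝓝 0) :=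
    tendsto_pow_atTop_nhds_zero_of_lt_one (by norm_num) (by norm_num)
  have hv' : Tendsto (fun n => (s n).2) atTop (𝓝 v) := by
    rw [tendsto_iff_norm_sub_tendsto_zero]
    refine squeeze_zero (fun _ => norm_nonneg _) (g := fun n => (1 / 2 : ℝ) ^ n * δ) (fun n => ?_)
      (by simpa using hpow.mul_const δ)
    rw [norm_sub_rev, hrem, norm_smul, Real.norm_of_nonneg (by positivity), pow_succ]
    have h1 := mem_ball_zero_iff.1 (hwb n)
    have h2 : (0 : ℝ) < (1 / 2) ^ n := by positivity
    nlinarith [mul_le_mul_of_nonneg_left h1.le h2.le, norm_nonneg (w n)]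
  refine ⟨x, le_of_tendsto hx.norm (Eventually.of_forall hnorm), ?_⟩
  have hlim : Tendsto (fun n => s n + ((1 / 2 : ℝ) ^ n) • p (w 0)) atTop
      (𝓝 ((x, v) + (0 : ℝ) • p (w 0))) :=
    (hx.prodMk_nhds hv').add (hpow.smul_const _)
  rw [zero_smul, add_zero] at hlim
  exact hRc.mem_of_tendsto hlim (Eventually.of_forall fun n => hmem n _ (hp _ (hwb 0)).2.1)

/-- A bounded form of the Robinson–Ursescu theorem. -/
theorem exists_ball_subset_boundedImage [CompleteSpace X] [CompleteSpace V] {R : Set (X × V)}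
    (hRc : IsClosed R) (hR : Convex ℝ R) (habs : ∀ v, ∃ t : ℝ, 0 < t ∧ ∃ x, (x, t⁻¹ • v) ∈ R) :
    ∃ δ > 0, ∃ N, Metric.ball 0 δ ⊆ boundedImage R N := by
  have habs' : ∀ v, ∃ t : ℝ, 0 < t ∧ ∃ j : ℕ, t⁻¹ • v ∈ boundedImage R j := by
    intro v
    obtain ⟨t, ht, x, hx⟩ := habs v
    obtain ⟨j, hj⟩ := exists_nat_ge ‖x‖
    exact ⟨t, ht, j, x, hj, hx⟩
  obtain ⟨j₀, hj₀⟩ : ∃ j : ℕ, (0 : V) ∈ boundedImage R j := by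
    obtain ⟨t, -, j, hj⟩ := habs' 0
    exact ⟨j, by simpa using hj⟩
  -- Closed sets for Baire's theorem. They cover `V` because `0` lies in a bounded image, so
  -- convexity shrinks `t⁻¹ • v` to `(m + 1)⁻¹ • v` for `m ≥ t`.
  let C : ℕ × ℕ → Set V := fun k => {v | ((k.2 : ℝ) + 1)⁻¹ • v ∈ closure (boundedImage R k.1)}
  have hC : ∀ k, IsClosed (C k) := fun k => isClosed_closure.preimage (continuous_const_smul _)
  have hU : ⋃ k, C k = Set.univ := by
    refine Set.eq_univ_of_forall fun v => ?_
    obtain ⟨t, ht, j, hj⟩ := habs' v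
    obtain ⟨m, hm⟩ := exists_nat_ge t
    refine Set.mem_iUnion.2 ⟨(max j j₀, m), subset_closure ?_⟩
    have h1 := boundedImage_mono R
      (show (j : ℝ) ≤ (max j j₀ : ℕ) by exact_mod_cast le_max_left _ _) hj
    have h2 := boundedImage_mono R
      (show (j₀ : ℝ) ≤ (max j j₀ : ℕ) by exact_mod_cast le_max_right _ _) hj₀
    have hm' : (0 : ℝ) < (m : ℝ) + 1 := by positivity
    have h3 : t / ((m : ℝ) + 1) ≤ 1 := by rw [div_le_one hm']; linarith
    have := convex_boundedImage hR _ h1 h2 (a := t / (m + 1)) (b := 1 - t / (m + 1))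
      (by positivity) (by linarith) (by ring)
    rw [smul_zero, add_zero, smul_smul] at this
    convert this using 2
    field_simp
  obtain ⟨⟨n, m⟩, v₁, hv₁⟩ := nonempty_interior_of_iUnion_of_closed hC hU
  obtain ⟨ρ, hρ, hball⟩ := Metric.isOpen_iff.1 isOpen_interior v₁ hv₁
  have hball' := hball.trans interior_subset
  -- A point on the ray opposite to the centre of the ball: the convex combination with weight `(1 +
  -- t)⁻¹` on the ball cancels the centre.
  obtain ⟨t, ht, j, hj⟩ := habs' (-((m + 1 : ℝ)⁻¹ • v₁))
  set N : ℕ := max n j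
  have h1 := boundedImage_mono R (show (n : ℝ) ≤ (N : ℕ) by exact_mod_cast le_max_left _ _)
  have h2 := boundedImage_mono R (show (j : ℝ) ≤ (N : ℕ) by exact_mod_cast le_max_right _ _) hj
  have hm' : (0 : ℝ) < (m : ℝ) + 1 := by positivity
  refine ⟨(1 + t)⁻¹ * (m + 1 : ℝ)⁻¹ * ρ / 2, by positivity, N,
    ball_subset_boundedImage_of_subset_closure hRc hR (by positivity) fun v hv => ?_⟩
  have hmem : v₁ + ((m + 1) * (1 + t)) • v ∈ Metric.ball v₁ ρ := by
    rw [mem_ball_zero_iff] at hv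
    rw [mem_ball_iff_norm, add_sub_cancel_left, norm_smul, Real.norm_of_nonneg (by positivity)]
    have h3 : (0 : ℝ) < (m + 1) * (1 + t) := by positivity
    calc (m + 1) * (1 + t) * ‖v‖ < (m + 1) * (1 + t) * ((1 + t)⁻¹ * (m + 1 : ℝ)⁻¹ * ρ) := by gcongr
      _ = ρ := by field_simp
  have h4 : ((m : ℝ) + 1)⁻¹ • (v₁ + ((m + 1) * (1 + t)) • v) ∈ closure (boundedImage R N) :=
    closure_mono h1 (hball' hmem)
  have := (convex_boundedImage hR N).closure h4 (subset_closure h2) (a := (1 + t)⁻¹)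
    (b := 1 - (1 + t)⁻¹) (by positivity)
    (by rw [sub_nonneg]; exact inv_le_one_of_one_le₀ (by linarith)) (by ring)
  convert this using 1
  have h5 : (1 - (1 + t)⁻¹) * t⁻¹ = (1 + t)⁻¹ := by field_simp; ring
  rw [smul_add, smul_add, smul_smul, smul_smul, smul_smul, smul_smul, smul_neg, smul_smul, h5]
  have h6 : (1 + t)⁻¹ * (m + 1 : ℝ)⁻¹ * ((m + 1) * (1 + t)) = 1 := by field_simp
  rw [h6, one_smul]
  abel

/-- Duality for the perturbation function of a continuous linear functional on a closed convex
multifunction: under the qualification condition the dual optimum is attained. -/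
theorem exists_dual_solution [CompleteSpace X] [CompleteSpace V] {R : Set (X × V)}
    (hRc : IsClosed R) (hR : Convex ℝ R) (habs : ∀ v, ∃ t : ℝ, 0 < t ∧ ∃ x, (x, t⁻¹ • v) ∈ R)
    (l : StrongDual ℝ X) {m : ℝ} (hm : ∀ x, (x, (0 : V)) ∈ R → m ≤ l x) :
    ∃ ζ : StrongDual ℝ V, ∀ k ∈ R, m + ζ k.2 ≤ l k.1 := by
  obtain ⟨δ, hδ, N, hN⟩ := exists_ball_subset_boundedImage hRc hR habs
  have hQ : Convex ℝ {k : V × ℝ | ∃ x, (x, k.1) ∈ R ∧ l x = k.2} := by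
    rintro ⟨v, _⟩ ⟨x, h, rfl⟩ ⟨v', _⟩ ⟨x', h', rfl⟩ a b ha hb hab
    exact ⟨a • x + b • x', hR h h' ha hb hab, by simp⟩
  obtain ⟨ζ, hζ⟩ := exists_affine_minorant hQ (m := m) (C := ‖l‖ * N) hδ (fun v hv => by
      obtain ⟨x, hx, hxR⟩ := hN (mem_ball_zero_iff.2 hv)
      have : ‖l x‖ ≤ ‖l‖ * N := l.le_of_opNorm_le_of_le le_rfl hx
      exact ⟨l x, (le_abs_self _).trans this, x, hxR, rfl⟩) (by
      rintro _ ⟨x, hx, rfl⟩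
      exact hm x hx)
  exact ⟨ζ, fun k hk => hζ (k.2, l k.1) ⟨k.1, hk, rfl⟩⟩

end RobinsonUrsescu

/-! ### Partial infimal convolution and its conjugate. -/

variable {E : Type*} [NormedAddCommGroup E] [NormedSpace ℝ E]

/-- The Fenchel conjugate of a function with epigraph `A` is bounded by `M` at `(y, z)`. -/
def ConjLE (A : Set ((E × StrongDual ℝ E) × ℝ)) (y : StrongDual ℝ E)
    (z : StrongDual ℝ (StrongDual ℝ E)) (M : ℝ) : Prop :=
  ∀ p ∈ A, y p.1.1 + z p.1.2 - p.2 ≤ M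

/-- The epigraph of the partial infimal convolution, in the first variable, of two functions on
`E × E*` given by their epigraphs. -/
def episum (A A' : Set ((E × StrongDual ℝ E) × ℝ)) : Set ((E × StrongDual ℝ E) × ℝ) :=
  {p | ∃ x u r s, ((x, p.1.2), r) ∈ A ∧ ((u, p.1.2), s) ∈ A' ∧ p = ((x + u, p.1.2), r + s)}

theorem convex_episum {A A' : Set ((E × StrongDual ℝ E) × ℝ)} (hA : Convex ℝ A)
    (hA' : Convex ℝ A') : Convex ℝ (episum A A') := by
  rintro ⟨⟨_, w⟩, _⟩ ⟨x, u, r, s, h, h', he⟩ ⟨⟨_, w'⟩, _⟩ ⟨x', u', r', s', k, k', ke⟩ a b ha hb hab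
  simp only [Prod.mk.injEq, and_true] at he ke
  obtain ⟨rfl, rfl⟩ := he
  obtain ⟨rfl, rfl⟩ := ke
  refine ⟨a • x + b • x', a • u + b • u', a * r + b * r', a * s + b * s',
    hA h k ha hb hab, hA' h' k' ha hb hab, ?_⟩
  simp only [Prod.smul_mk, Prod.mk_add_mk, smul_eq_mul, Prod.mk.injEq, and_true]
  constructor
  · module
  · ring

/-- Attouch–Brezis: the conjugate of the partial infimal convolution is the exact partial infimal
convolution, in the second variable, of the conjugates. -/
theorem exists_conj_split_of_conjLE_episum [CompleteSpace E]
    {A A' : Set ((E × StrongDual ℝ E) × ℝ)}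
    (hA : Convex ℝ A) (hA' : Convex ℝ A') (hAc : IsClosed A) (hAc' : IsClosed A')
    (hcone : IsClosedSubspace (coneDiff ((fun p => p.1.2) '' A) ((fun p => p.1.2) '' A')))
    {y : StrongDual ℝ E} {z : StrongDual ℝ (StrongDual ℝ E)} {M : ℝ}
    (hM : ConjLE (episum A A') y z M) :
    ∃ ζ : StrongDual ℝ (StrongDual ℝ E), ∀ p ∈ A, ∀ p' ∈ A',
      (y p.1.1 + (z - ζ) p.1.2 - p.2) + (y p'.1.1 + ζ p'.1.2 - p'.2) ≤ M := by
  obtain ⟨hcl, F, hF⟩ := hcone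
  rw [← hF] at hcl
  have : CompleteSpace F := hcl.completeSpace_coe
  let l : StrongDual ℝ (E × E × StrongDual ℝ E × ℝ × ℝ) :=
    { toFun := fun k => k.2.2.2.1 + k.2.2.2.2 - y k.1 - y k.2.1 - z k.2.2.1
      map_add' := fun k k' => by simp only [Prod.fst_add, Prod.snd_add, map_add]; ring
      map_smul' := fun a k => by
        simp only [Prod.smul_fst, Prod.smul_snd, map_smul, smul_eq_mul, RingHom.id_apply]; ring
      cont := by fun_prop }
  -- The perturbation `v ∈ F` lets the two second arguments differ; at `v = 0` minimising `l` is
  -- computing the conjugate of the convolution.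
  let R : Set ((E × E × StrongDual ℝ E × ℝ × ℝ) × F) :=
    {k | ((k.1.1, k.1.2.2.1), k.1.2.2.2.1) ∈ A ∧
      ((k.1.2.1, k.1.2.2.1 + (k.2 : StrongDual ℝ E)), k.1.2.2.2.2) ∈ A'}
  obtain ⟨ζ₀, hζ₀⟩ : ∃ ζ : StrongDual ℝ F, ∀ k ∈ R, -M + ζ k.2 ≤ l k.1 := by
    refine exists_dual_solution (R := R) ?_ ?_ ?_ l ?_
    · exact (hAc.preimage (by fun_prop)).inter (hAc'.preimage (by fun_prop))
    · rintro ⟨⟨x, u, w, r, s⟩, v⟩ ⟨h, h'⟩ ⟨⟨x', u', w', r', s'⟩, v'⟩ ⟨k, k'⟩ a b ha hb hab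
      refine ⟨hA h k ha hb hab, ?_⟩
      convert hA' h' k' ha hb hab using 1
      simp only [Prod.smul_mk, Prod.mk_add_mk, Submodule.coe_add, Submodule.coe_smul, Prod.mk.injEq,
        and_true, true_and]
      module
    · intro v
      have hv : (-v : StrongDual ℝ E) ∈ (F : Set (StrongDual ℝ E)) := F.neg_mem v.2
      rw [hF] at hv
      simp only [coneDiff, Set.mem_iUnion] at hv
      obtain ⟨t, ht, hv⟩ := hv
      obtain ⟨d, hdm, hd⟩ := Set.mem_smul_set.1 hv
      obtain ⟨w, ⟨p, hp, hpw⟩, w', ⟨p', hp', hpw'⟩, hdw⟩ := Set.mem_sub.1 hdm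
      subst hpw hpw' hdw
      refine ⟨t, ht, (p.1.1, p'.1.1, p.1.2, p.2, p'.2), hp, ?_⟩
      have hv' : t⁻¹ • (v : StrongDual ℝ E) = p'.1.2 - p.1.2 := by
        have h1 : (v : StrongDual ℝ E) = -(t • (p.1.2 - p'.1.2)) := by
          simp only at hd
          rw [hd, neg_neg]
        rw [h1, smul_neg, smul_smul, inv_mul_cancel₀ ht.ne', one_smul, neg_sub]
      simp only [Submodule.coe_smul, hv', add_sub_cancel]
      exact hp'
    · rintro ⟨x, u, w, r, s⟩ ⟨h, h'⟩
      simp only [ZeroMemClass.coe_zero, add_zero] at h h'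
      have := hM ((x + u, w), r + s) ⟨x, u, r, s, h, h', rfl⟩
      simp only [map_add] at this
      change -M ≤ r + s - y x - y u - z w
      linarith
  -- Only differences of points of the two projections matter, and these lie in `F` (take `t = 1` in
  -- the cone), so any extension will do.
  obtain ⟨ζ, hζ, -⟩ := exists_extension_norm_eq F ζ₀
  refine ⟨ζ, ?_⟩
  rintro ⟨⟨x, w⟩, r⟩ hp ⟨⟨u, w'⟩, s⟩ hp'
  have hmem : w - w' ∈ F := by
    rw [← SetLike.mem_coe, hF]
    simp only [coneDiff, Set.mem_iUnion]
    exact ⟨1, one_pos, by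
      rw [one_smul]; exact Set.sub_mem_sub ⟨_, hp, rfl⟩ ⟨_, hp', rfl⟩⟩
  have hmem' : w' - w ∈ F := by rw [← neg_sub]; exact F.neg_mem hmem
  have : -M + ζ₀ ⟨w' - w, hmem'⟩ ≤ r + s - y x - y u - z w :=
    hζ₀ ((x, u, w, r, s), ⟨w' - w, hmem'⟩) ⟨hp, by simpa using hp'⟩
  rw [← hζ] at this
  simp only [map_sub] at this
  simp only [sub_apply]
  linarith

/-! ### Elementary estimates for `qL` and `rL`. -/

theorem isQuasidense_iff {S : E → Set (StrongDual ℝ E)} :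
    IsQuasidense S ↔ ∀ c, ∀ ε > 0, ∃ a ∈ graph S, rL (a - c) ≤ ε := by
  refine ⟨fun h c ε hε => ?_, fun h c => ?_⟩
  · have : (⨅ a ∈ graph S, ((rL (a - c) : ℝ) : EReal)) < (ε : EReal) :=
      lt_of_le_of_lt (h c) (by exact_mod_cast hε)
    simp only [iInf_lt_iff] at this
    obtain ⟨a, ha, hlt⟩ := this
    exact ⟨a, ha, by exact_mod_cast hlt.le⟩
  · by_contra hcon
    obtain ⟨ε, hε, hlt⟩ := EReal.lt_iff_exists_real_btwn.1 (not_le.1 hcon)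
    obtain ⟨a, ha, hle⟩ := h c (ε / 2) (half_pos (by exact_mod_cast hε))
    have h1 : (ε : EReal) < ((rL (a - c) : ℝ) : EReal) := hlt.trans_le (iInf₂_le a ha)
    have h2 : ε < rL (a - c) := by exact_mod_cast h1
    have h3 : 0 < ε := by exact_mod_cast hε
    linarith

theorem abs_qL_le (b : E × StrongDual ℝ E) : |qL b| ≤ ‖b.1‖ * ‖b.2‖ := by
  rw [mul_comm]; exact b.2.le_opNorm b.1

theorem rL_nonneg (b : E × StrongDual ℝ E) : 0 ≤ rL b := by
  have := (abs_le.1 (abs_qL_le b)).1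
  unfold rL
  nlinarith [sq_nonneg (‖b.1‖ - ‖b.2‖)]

theorem half_sq_norm_le (b : E × StrongDual ℝ E) :
    (1 / 2) * ‖b‖ ^ 2 ≤ (1 / 2) * ‖b.1‖ ^ 2 + (1 / 2) * ‖b.2‖ ^ 2 := by
  rcases max_choice ‖b.1‖ ‖b.2‖ with h | h <;> rw [Prod.norm_def, h] <;>
    nlinarith [sq_nonneg ‖b.1‖, sq_nonneg ‖b.2‖]

theorem qL_add (b d : E × StrongDual ℝ E) :
    qL (b + d) = qL b + (d.2 b.1 + b.2 d.1) + qL d := by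
  simp only [qL, Prod.fst_add, Prod.snd_add, map_add, add_apply]; ring

theorem qL_sub (b d : E × StrongDual ℝ E) :
    qL (b - d) = qL b - (d.2 b.1 + b.2 d.1) + qL d := by
  simp only [qL, Prod.fst_sub, Prod.snd_sub, map_sub, sub_apply]; ring

theorem abs_cross_le (b d : E × StrongDual ℝ E) : |d.2 b.1 + b.2 d.1| ≤ 2 * ‖b‖ * ‖d‖ := by
  have h1 : |d.2 b.1| ≤ ‖d‖ * ‖b‖ :=
    (d.2.le_opNorm b.1).trans 
      (mul_le_mul (norm_snd_le d) (norm_fst_le b) (norm_nonneg _) (norm_nonneg _))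
  have h2 : |b.2 d.1| ≤ ‖b‖ * ‖d‖ :=
    (b.2.le_opNorm d.1).trans 
      (mul_le_mul (norm_snd_le b) (norm_fst_le d) (norm_nonneg _) (norm_nonneg _))
  calc _ ≤ |d.2 b.1| + |b.2 d.1| := abs_add_le _ _
    _ ≤ _ := by linarith

theorem continuous_qL : Continuous (qL : E × StrongDual ℝ E → ℝ) := by
  unfold qL; fun_prop

/-! ### Coincidence sets of convex functions above the duality pairing. -/

section Coincidence

variable {A : Set ((E × StrongDual ℝ E) × ℝ)}

/-- Fenchel–Rockafellar: a convex function whose conjugate dominates the duality pairing is close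
to the duality pairing near every point. -/
theorem exists_sub_qL_add_rL_le (hA : Convex ℝ A)
    (hconj : ∀ y z M, ConjLE A y z M → z y ≤ M) (c : E × StrongDual ℝ E) {ε : ℝ} (hε : 0 < ε) :
    ∃ p ∈ A, p.2 - qL p.1 + rL (p.1 - c) ≤ ε := by
  by_contra! hcon
  obtain ⟨p₀, hp₀⟩ : A.Nonempty := by
    rw [Set.nonempty_iff_ne_empty]
    rintro rfl
    have := hconj 0 0 (-1) (fun p hp => absurd hp (Set.notMem_empty p))
    simp at this
    linarith
  let h : E × StrongDual ℝ E → ℝ := fun w => (1 / 2) * ‖w.1‖ ^ 2 + (1 / 2) * ‖w.2‖ ^ 2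
  -- Expanding `rL (p.1 - c)` cancels the nonconvex term `qL p.1`. What is left is convex plus `h`,
  -- and `Q` is the epigraph for the perturbation of the argument of `h`.
  let Q : Set ((E × StrongDual ℝ E) × ℝ) := {k | ∃ p ∈ A, ∃ w, k.1 = w - (p.1 - c) ∧
    p.2 - (c.2 p.1.1 + p.1.2 c.1) + qL c - ε + h w ≤ k.2}
  have hconv : ∀ {X : Type _} [NormedAddCommGroup X] [NormedSpace ℝ X] (x y : X) {a b : ℝ},
      0 ≤ a → 0 ≤ b → a + b = 1 → ‖a • x + b • y‖ ^ 2 ≤ a * ‖x‖ ^ 2 + b * ‖y‖ ^ 2 := by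
    intro X _ _ x y a b ha hb hab
    have h1 : ‖a • x + b • y‖ ≤ a * ‖x‖ + b * ‖y‖ := by
      refine (norm_add_le _ _).trans ?_
      rw [norm_smul, norm_smul, Real.norm_of_nonneg ha, Real.norm_of_nonneg hb]
    have h2 := pow_le_pow_left₀ (norm_nonneg _) h1 2
    obtain rfl : b = 1 - a := by linarith
    nlinarith [mul_nonneg (mul_nonneg ha hb) (sq_nonneg (‖x‖ - ‖y‖))]
  have hQ : Convex ℝ Q := by
    rintro ⟨v, t⟩ ⟨p, hp, w, hv, ht⟩ ⟨v', t'⟩ ⟨p', hp', w', hv', ht'⟩ a b ha hb hab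
    refine ⟨a • p + b • p', hA hp hp' ha hb hab, a • w + b • w', ?_, ?_⟩
    · simp only at hv hv'
      have hcc : c = a • c + b • c := by rw [← add_smul, hab, one_smul]
      simp only [Prod.smul_mk, Prod.mk_add_mk, Prod.fst_add, Prod.smul_fst, hv, hv']
      nth_rewrite 3 [hcc]
      module
    · have h1 := hconv w.1 w'.1 ha hb hab
      have h2 := hconv w.2 w'.2 ha hb hab
      simp only [h] at ht ht' ⊢
      have h3 := mul_le_mul_of_nonneg_left ht ha
      have h4 := mul_le_mul_of_nonneg_left ht' hb
      simp only [Prod.snd_add, Prod.smul_snd, Prod.fst_add, Prod.smul_fst, map_add, map_smul,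
        add_apply, smul_apply, smul_eq_mul, Prod.smul_mk, Prod.mk_add_mk]
      have h5 : qL c = a * qL c + b * qL c := by rw [← add_mul, hab, one_mul]
      have h6 : ε = a * ε + b * ε := by rw [← add_mul, hab, one_mul]
      linarith
  obtain ⟨ζ, hζ⟩ := exists_affine_minorant (Q := Q) hQ (δ := 1) (m := 0) one_pos
    (C := p₀.2 - (c.2 p₀.1.1 + p₀.1.2 c.1) + qL c - ε + (1 + ‖p₀.1 - c‖) ^ 2) (by
      intro v hv
      refine ⟨_, le_rfl, p₀, hp₀, v + (p₀.1 - c), by simp, ?_⟩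
      have h0 : ‖v + (p₀.1 - c)‖ ≤ 1 + ‖p₀.1 - c‖ := (norm_add_le _ _).trans (by linarith)
      have h1 := pow_le_pow_left₀ (norm_nonneg _) ((norm_fst_le (v + (p₀.1 - c))).trans h0) 2
      have h2 := pow_le_pow_left₀ (norm_nonneg _) ((norm_snd_le (v + (p₀.1 - c))).trans h0) 2
      simp only [h]
      linarith) (by
      rintro t ⟨p, hp, w, hw, ht⟩
      obtain rfl : w = p.1 - c := (sub_eq_zero.1 hw.symm)
      have := hcon p hp
      rw [rL, qL_sub] at this
      simp only [h] at ht
      linarith)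
  set y : StrongDual ℝ E := ζ.comp (ContinuousLinearMap.inl ℝ E (StrongDual ℝ E)) with hy
  set z : StrongDual ℝ (StrongDual ℝ E) :=
    ζ.comp (ContinuousLinearMap.inr ℝ E (StrongDual ℝ E)) with hz
  have hyz : ∀ b, ζ b = y b.1 + z b.2 := by
    intro b
    simp [hy, hz, ← map_add]
  obtain ⟨w₁, hw₁⟩ := exists_half_sq_norm_sub_le y (ε := ε / 4) (by positivity)
  obtain ⟨w₂, hw₂⟩ := exists_half_sq_norm_sub_le z (ε := ε / 4) (by positivity)
  -- Taking the supremum over `w` replaces `h` by its conjugate, up to `ε / 2`. The resulting bound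
  -- forces `z y + ½‖y‖² + ½‖z‖² ≤ -ε / 2`, which is impossible.
  have key := hconj (c.2 - y) (NormedSpace.inclusionInDoubleDual ℝ E c.1 - z)
    (qL c - ε - y c.1 - z c.2 + (ε / 2 - (1 / 2) * ‖y‖ ^ 2 - (1 / 2) * ‖z‖ ^ 2)) (by
      intro p hp
      have := hζ ((w₁, w₂) - (p.1 - c), _) ⟨p, hp, (w₁, w₂), rfl, le_rfl⟩
      simp only [hyz, h, Prod.fst_sub, Prod.snd_sub, map_sub] at this
      simp only [sub_apply, NormedSpace.dual_def]
      linarith)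
  simp only [map_sub, sub_apply, NormedSpace.dual_def] at key
  have h1 := (abs_le.1 (z.le_opNorm y)).1
  have h2 : qL c = c.2 c.1 := rfl
  nlinarith [sq_nonneg (‖y‖ - ‖z‖)]

/-- The set where the conjugate of `A`, restricted to `E × E*`, is at most the duality pairing,
as a multifunction. -/
def conjCoincidence (A : Set ((E × StrongDual ℝ E) × ℝ)) : E → Set (StrongDual ℝ E) :=
  fun x => {w | ConjLE A w (NormedSpace.inclusionInDoubleDual ℝ E x) (w x)}

theorem mem_graph_conjCoincidence {b : E × StrongDual ℝ E} :
    b ∈ graph (conjCoincidence A) ↔ ∀ p ∈ A, b.2 p.1.1 + p.1.2 b.1 - p.2 ≤ qL b :=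
  Iff.rfl

theorem isClosedGraph_conjCoincidence : IsClosedGraph (conjCoincidence A) := by
  have : graph (conjCoincidence A) =
      ⋂ p ∈ A, {b | b.2 p.1.1 + p.1.2 b.1 - p.2 ≤ qL b} := by
    ext b
    simp only [mem_graph_conjCoincidence, Set.mem_iInter, Set.mem_ofPred_eq]
  rw [IsClosedGraph, this]
  exact isClosed_biInter fun p _ => isClosed_le (by fun_prop) continuous_qL

/-- Convexity bounds the conjugate at the midpoint of `a` and `b` by the average of `qL a` and `qL
b`; since it dominates the pairing there, the parallelogram identity gives `0 ≤ qL (a - b)`. -/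
theorem isMonotone_conjCoincidence (hconj : ∀ y z M, ConjLE A y z M → z y ≤ M) :
    IsMonotone (conjCoincidence A) := by
  intro a ha b hb
  have h := hconj ((1 / 2 : ℝ) • (a.2 + b.2))
    (NormedSpace.inclusionInDoubleDual ℝ E ((1 / 2 : ℝ) • (a.1 + b.1)))
    ((1 / 2) * (qL a + qL b)) (by
      intro p hp
      have h1 := mem_graph_conjCoincidence.1 ha p hp
      have h2 := mem_graph_conjCoincidence.1 hb p hp
      simp only [NormedSpace.dual_def, map_smul, map_add, smul_apply, add_apply, smul_eq_mul]
      linarith)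
  simp only [NormedSpace.dual_def, map_smul, map_add, smul_apply, add_apply, smul_eq_mul] at h
  rw [qL_sub]
  simp only [qL] at h ⊢
  linarith

/-- A convex function dominating the duality pairing is almost monotone where it nearly coincides
with it. -/
theorem neg_two_mul_le_qL_sub (hA : Convex ℝ A) (hq : ∀ p ∈ A, qL p.1 ≤ p.2)
    {p p' : (E × StrongDual ℝ E) × ℝ} (hp : p ∈ A) (hp' : p' ∈ A) :
    -2 * ((p.2 - qL p.1) + (p'.2 - qL p'.1)) ≤ qL (p.1 - p'.1) := by
  have := hq _ (hA hp hp' (a := 1 / 2) (b := 1 / 2) (by norm_num) (by norm_num) (by norm_num))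
  simp only [Prod.fst_add, Prod.snd_add, Prod.smul_fst, Prod.smul_snd, qL, map_add, map_smul,
    add_apply, smul_apply, smul_eq_mul] at this
  rw [qL_sub]
  simp only [qL]
  linarith

/-- First-order argument: `qL` lies below the function on the segment from `p n` to any `k ∈ A`. Let
`n → ∞`, divide by `t`, then let `t → 0`. No closedness of `A` is needed. -/
theorem mem_conjCoincidence_of_tendsto (hA : Convex ℝ A) (hq : ∀ p ∈ A, qL p.1 ≤ p.2)
    {p : ℕ → (E × StrongDual ℝ E) × ℝ} (hp : ∀ n, p n ∈ A) {b : E × StrongDual ℝ E}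
    (hb : Tendsto (fun n => (p n).1) atTop (𝓝 b))
    (he : Tendsto (fun n => (p n).2 - qL (p n).1) atTop (𝓝 0)) :
    b ∈ graph (conjCoincidence A) := by
  refine mem_graph_conjCoincidence.2 fun k hk => ?_
  have hqlim : Tendsto (fun n => qL (p n).1) atTop (𝓝 (qL b)) :=
    (continuous_qL.tendsto b).comp hb
  have hlim : Tendsto (fun n => (p n).2) atTop (𝓝 (qL b)) := by
    simpa using he.add hqlim
  have step : ∀ t : ℝ, 0 < t → t ≤ 1 →
      (b.2 k.1.1 + k.1.2 b.1) - k.2 - qL b ≤ t * -qL (k.1 - b) := by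
    intro t ht ht1
    have h1 : qL ((1 - t) • b + t • k.1) ≤ (1 - t) * qL b + t * k.2 := by
      refine le_of_tendsto_of_tendsto
        ((continuous_qL.tendsto _).comp ((hb.const_smul (1 - t)).add_const (t • k.1)))
        ((hlim.const_mul (1 - t)).add_const (t * k.2)) (Eventually.of_forall fun n => ?_)
      exact hq _ (hA (hp n) hk (by linarith) ht.le (by ring))
    rw [qL_sub]
    simp only [qL, Prod.fst_add, Prod.snd_add, Prod.smul_fst, Prod.smul_snd, map_add, map_smul,
      add_apply, smul_apply, smul_eq_mul] at h1 ⊢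
    refine le_of_mul_le_mul_left ?_ ht
    nlinarith
  have hl : Tendsto (fun t : ℝ => t * -qL (k.1 - b)) (𝓝[>] 0) (𝓝 0) := by
    have : Tendsto (fun t : ℝ => t * -qL (k.1 - b)) (𝓝 0) (𝓝 (0 * -qL (k.1 - b))) :=
      tendsto_id.mul_const _
    rw [zero_mul] at this
    exact this.mono_left nhdsWithin_le_nhds
  have := ge_of_tendsto hl (by
    filter_upwards [Ioc_mem_nhdsGT one_pos] with t ht using step t ht.1 ht.2)
  linarith

/-- Each iterate is the centre for the next approximation, with tolerance `(η / 2 ^ (n + 1)) ^ 2`.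
Small `rL` alone does not bound a step; almost monotonicity bounds `qL` of the step below, which
leaves its squared norm small. The steps `4η / 2 ^ n` sum to `8η`. -/
theorem exists_mem_conjCoincidence_near [CompleteSpace E] (hA : Convex ℝ A)
    (hq : ∀ p ∈ A, qL p.1 ≤ p.2)
    (hconj : ∀ y z M, ConjLE A y z M → z y ≤ M) {η : ℝ} (hη : 0 < η)
    {p₀ : (E × StrongDual ℝ E) × ℝ} (hp₀ : p₀ ∈ A) (he₀ : p₀.2 - qL p₀.1 ≤ η ^ 2) :
    ∃ b ∈ graph (conjCoincidence A), ‖b - p₀.1‖ ≤ 8 * η := by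
  have hstep : ∀ (n : ℕ) (p : (E × StrongDual ℝ E) × ℝ), ∃ p' ∈ A,
      p'.2 - qL p'.1 + rL (p'.1 - p.1) ≤ (η * (1 / 2) ^ (n + 1)) ^ 2 :=
    fun n p => exists_sub_qL_add_rL_le hA hconj p.1 (by positivity)
  choose f hfA hf using hstep
  let p : ℕ → (E × StrongDual ℝ E) × ℝ := fun n => Nat.rec p₀ f n
  have hpA : ∀ n, p n ∈ A := fun n => by
    cases n with
    | zero => exact hp₀
    | succ n => exact hfA _ _
  have hps : ∀ n, (p (n + 1)).2 - qL (p (n + 1)).1 + rL ((p (n + 1)).1 - (p n).1) ≤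
      (η * (1 / 2) ^ (n + 1)) ^ 2 := fun n => hf n (p n)
  have hpe : ∀ n, (p n).2 - qL (p n).1 ≤ (η * (1 / 2) ^ n) ^ 2 := by
    intro n
    cases n with
    | zero =>
      change p₀.2 - qL p₀.1 ≤ _
      simpa using he₀
    | succ n => linarith [hps n, rL_nonneg ((p (n + 1)).1 - (p n).1)]
  have hdist : ∀ n, dist (p n).1 (p (n + 1)).1 ≤ (4 * η) * (1 / 2) ^ n := by
    intro n
    rw [dist_comm, dist_eq_norm]
    have h1 := hps n
    have h2 := neg_two_mul_le_qL_sub hA hq (hpA (n + 1)) (hpA n)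
    have h3 := hpe n
    have h4 := hpe (n + 1)
    have h5 := half_sq_norm_le ((p (n + 1)).1 - (p n).1)
    have h6 := hq _ (hpA (n + 1))
    rw [rL] at h1
    have h7 : (η * (1 / 2) ^ (n + 1)) ^ 2 = (η * (1 / 2) ^ n) ^ 2 / 4 := by ring
    refine le_of_sq_le_sq ?_ (by positivity)
    have h8 : (4 * η * (1 / 2) ^ n) ^ 2 = 16 * (η * (1 / 2) ^ n) ^ 2 := by ring
    rw [h8]
    nlinarith [sq_nonneg (η * (1 / 2) ^ n)]
  obtain ⟨b, hb⟩ := cauchySeq_tendsto_of_complete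
    (cauchySeq_of_le_geometric (1 / 2) (4 * η) (by norm_num) hdist)
  refine ⟨b, mem_conjCoincidence_of_tendsto hA hq hpA hb ?_, ?_⟩
  · refine squeeze_zero (fun n => sub_nonneg.2 (hq _ (hpA n))) hpe ?_
    have : Tendsto (fun n : ℕ => (1 / 2 : ℝ) ^ n) atTop (𝓝 0) :=
      tendsto_pow_atTop_nhds_zero_of_lt_one (by norm_num) (by norm_num)
    simpa using (this.const_mul η).pow 2
  · have := dist_le_of_le_geometric_of_tendsto₀ (1 / 2) (4 * η) (by norm_num) hdist hb
    rw [dist_comm, dist_eq_norm] at this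
    calc _ ≤ _ := this
      _ = _ := by ring

/-- A bound independent of the tolerance, needed because `rL` is not coercive. Comparison with one
fixed near-point `p'` through almost monotonicity supplies it. -/
theorem exists_norm_sub_le_of_near (hA : Convex ℝ A) (hq : ∀ p ∈ A, qL p.1 ≤ p.2)
    (c : E × StrongDual ℝ E) :
    ∃ K, ∀ p ∈ A, p.2 - qL p.1 + rL (p.1 - c) ≤ 1 → ‖p.1 - c‖ ≤ K := by
  by_cases hne : ∃ p ∈ A, p.2 - qL p.1 + rL (p.1 - c) ≤ 1
  swap
  · push Not at hne
    exact ⟨0, fun p hp h => absurd h (not_le.2 (hne p hp))⟩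
  obtain ⟨p', hp', h'⟩ := hne
  refine ⟨6 * ‖p'.1 - c‖ + 10, fun p hp h => ?_⟩
  have h1 := neg_two_mul_le_qL_sub hA hq hp hp'
  have h2 := rL_nonneg (p.1 - c)
  have h3 := rL_nonneg (p'.1 - c)
  have h4 := hq p hp
  have h5 := half_sq_norm_le (p.1 - c)
  have h6 : qL (p.1 - p'.1) = qL (p.1 - c) - ((p'.1 - c).2 (p.1 - c).1 + (p.1 - c).2 (p'.1 - c).1)
      + qL (p'.1 - c) := by rw [← qL_sub]; congr 1; abel
  have h7 := (abs_le.1 (abs_cross_le (p.1 - c) (p'.1 - c))).1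
  have h8 : qL (p'.1 - c) ≤ ‖p'.1 - c‖ ^ 2 := by
    refine (le_abs_self _).trans ((abs_qL_le _).trans ?_)
    rw [sq]
    exact mul_le_mul (norm_fst_le _) (norm_snd_le _) (norm_nonneg _) (norm_nonneg _)
  rw [rL] at h h2
  have h9 := norm_nonneg (p.1 - c)
  have h10 := norm_nonneg (p'.1 - c)
  have h11 : rL (p'.1 - c) ≤ 1 := by linarith [hq p' hp']
  have main : (1 / 2) * ‖p.1 - c‖ ^ 2 ≤ 5 + 2 * ‖p.1 - c‖ * ‖p'.1 - c‖ + ‖p'.1 - c‖ ^ 2 := by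
    linarith
  by_contra! hlt
  nlinarith [mul_nonneg h10 (sub_nonneg.2 hlt.le)]

theorem isQuasidense_conjCoincidence [CompleteSpace E] (hA : Convex ℝ A)
    (hq : ∀ p ∈ A, qL p.1 ≤ p.2)
    (hconj : ∀ y z M, ConjLE A y z M → z y ≤ M) : IsQuasidense (conjCoincidence A) := by
  refine isQuasidense_iff.2 fun c ε hε => ?_
  obtain ⟨K, hK⟩ := exists_norm_sub_le_of_near hA hq c
  -- Bound for `rL (b - c)` when a point with `rL ≤ η ^ 2` and norm at most `K` is moved by at most
  -- `8 * η`.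
  have hlim : Tendsto (fun η : ℝ => η ^ 2 + 4 * K * (8 * η) + 2 * (8 * η) ^ 2) (𝓝[>] 0) (𝓝 0) := by
    have : Continuous fun η : ℝ => η ^ 2 + 4 * K * (8 * η) + 2 * (8 * η) ^ 2 := by fun_prop
    have := this.tendsto 0
    simp only [mul_zero, ne_eq, OfNat.ofNat_ne_zero, not_false_eq_true, zero_pow, add_zero] at this
    exact this.mono_left nhdsWithin_le_nhds
  obtain ⟨η, hηε, hη, hη1⟩ :=
    ((hlim.eventually (gt_mem_nhds hε)).and (Ioc_mem_nhdsGT one_pos)).exists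
  obtain ⟨p, hp, hpe⟩ := exists_sub_qL_add_rL_le hA hconj c (pow_pos hη 2)
  have hpK := hK p hp (hpe.trans (pow_le_one₀ hη.le hη1))
  obtain ⟨b, hb, hbp⟩ := exists_mem_conjCoincidence_near hA hq hconj hη hp
    (by linarith [rL_nonneg (p.1 - c)])
  refine ⟨b, hb, le_trans ?_ hηε.le⟩
  have hrL : rL (p.1 - c) ≤ η ^ 2 := by linarith [hq p hp]
  set d := p.1 - c
  set u := b - p.1
  have hbd : b - c = d + u := by simp only [d, u]; abel
  have h0 := norm_nonneg u
  have hd := norm_nonneg d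
  have hsq : ∀ {s t s' : ℝ}, 0 ≤ s → s ≤ t + s' → 0 ≤ t → 0 ≤ s' → t ≤ ‖d‖ → s' ≤ ‖u‖ →
      s ^ 2 ≤ t ^ 2 + 2 * ‖d‖ * ‖u‖ + ‖u‖ ^ 2 := by
    intro s t s' hs hst ht hs' h1 h2
    have := pow_le_pow_left₀ hs hst 2
    nlinarith [mul_le_mul h1 h2 hs' hd, pow_le_pow_left₀ hs' h2 2]
  have h1 : ‖(d + u).1‖ ^ 2 ≤ ‖d.1‖ ^ 2 + 2 * ‖d‖ * ‖u‖ + ‖u‖ ^ 2 :=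
    hsq (norm_nonneg _) (norm_add_le d.1 u.1) (norm_nonneg _) (norm_nonneg _)
      (norm_fst_le d) (norm_fst_le u)
  have h2 : ‖(d + u).2‖ ^ 2 ≤ ‖d.2‖ ^ 2 + 2 * ‖d‖ * ‖u‖ + ‖u‖ ^ 2 :=
    hsq (norm_nonneg _) (norm_add_le d.2 u.2) (norm_nonneg _) (norm_nonneg _)
      (norm_snd_le d) (norm_snd_le u)
  have h3 := (abs_le.1 (abs_cross_le d u)).2
  have h4 : qL u ≤ ‖u‖ ^ 2 := by
    refine (le_abs_self _).trans ((abs_qL_le _).trans ?_)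
    rw [sq]
    exact mul_le_mul (norm_fst_le _) (norm_snd_le _) (norm_nonneg _) (norm_nonneg _)
  rw [hbd, rL, qL_add]
  rw [rL] at hrL
  have h5 : ‖d‖ * ‖u‖ ≤ K * (8 * η) := mul_le_mul hpK hbp h0 (hd.trans hpK)
  have h6 := pow_le_pow_left₀ h0 hbp 2
  linarith

end Coincidence

/-! ### Fitzpatrick functions and extensions of quasidense monotone multifunctions. -/

/-- The epigraph of the Fitzpatrick function. -/
def fitzEpi (S : E → Set (StrongDual ℝ E)) : Set ((E × StrongDual ℝ E) × ℝ) :=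
  {p | ∀ a ∈ graph S, p.1.2 a.1 + a.2 p.1.1 - a.2 a.1 ≤ p.2}

variable {S T : E → Set (StrongDual ℝ E)}

theorem isClosed_fitzEpi : IsClosed (fitzEpi S) := by
  have : fitzEpi S = ⋂ a ∈ graph S, {p | p.1.2 a.1 + a.2 p.1.1 - a.2 a.1 ≤ p.2} := by
    ext p
    simp only [fitzEpi, Set.mem_iInter, Set.mem_ofPred_eq]
  rw [this]
  exact isClosed_biInter fun a _ => isClosed_le (by fun_prop) (by fun_prop)

theorem convex_fitzEpi : Convex ℝ (fitzEpi S) := by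
  intro p hp p' hp' s t hs ht hst a ha
  have h1 := mul_le_mul_of_nonneg_left (hp a ha) hs
  have h2 := mul_le_mul_of_nonneg_left (hp' a ha) ht
  simp only [Prod.fst_add, Prod.snd_add, Prod.smul_fst, Prod.smul_snd, map_add, map_smul,
    add_apply, smul_apply, smul_eq_mul]
  have h3 : a.2 a.1 = s * a.2 a.1 + t * a.2 a.1 := by rw [← add_mul, hst, one_mul]
  linarith

theorem fitzpatrick_le_iff {b : E × StrongDual ℝ E} {r : ℝ} :
    fitzpatrick S b ≤ r ↔ (b, r) ∈ fitzEpi S := by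
  simp only [fitzpatrick, iSup_le_iff, EReal.coe_le_coe_iff, fitzEpi, Set.mem_ofPred_eq]

theorem fitzpatrick_ne_bot (hne : (graph S).Nonempty) (b : E × StrongDual ℝ E) :
    fitzpatrick S b ≠ ⊥ := by
  obtain ⟨a, ha⟩ := hne
  intro h
  have : ((b.2 a.1 + a.2 b.1 - a.2 a.1 : ℝ) : EReal) ≤ fitzpatrick S b :=
    le_iSup₂ (f := fun (a : E × StrongDual ℝ E) (_ : a ∈ graph S) =>
      ((b.2 a.1 + a.2 b.1 - a.2 a.1 : ℝ) : EReal)) a ha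
  rw [h, le_bot_iff] at this
  exact EReal.coe_ne_bot _ this

theorem conjugate_fitzpatrick_le_iff (hne : (graph S).Nonempty) {y : StrongDual ℝ E}
    {z : StrongDual ℝ (StrongDual ℝ E)} {M : ℝ} :
    conjugate (fitzpatrick S) (y, z) ≤ M ↔ ConjLE (fitzEpi S) y z M := by
  rw [conjugate, iSup_le_iff]
  constructor
  · rintro h ⟨b, r⟩ hp
    have h1 := h b
    have h2 := fitzpatrick_le_iff.2 hp
    have h3 : ((y b.1 + z b.2 : ℝ) : EReal) - (r : EReal) ≤ M :=
      (EReal.sub_le_sub le_rfl h2).trans h1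
    exact_mod_cast h3
  · intro h b
    induction hφ : fitzpatrick S b using EReal.rec with
    | bot => exact absurd hφ (fitzpatrick_ne_bot hne b)
    | top => simp
    | coe r =>
      have := h (b, r) (fitzpatrick_le_iff.1 hφ.le)
      exact_mod_cast this

theorem snd_image_effDom_fitzpatrick (hne : (graph S).Nonempty) :
    Prod.snd '' effDom (fitzpatrick S) = (fun p => p.1.2) '' fitzEpi S := by
  ext w
  constructor
  · rintro ⟨b, ⟨hbot, htop⟩, rfl⟩
    exact ⟨(b, (fitzpatrick S b).toReal),
      fitzpatrick_le_iff.1 (EReal.le_coe_toReal htop), rfl⟩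
  · rintro ⟨⟨b, r⟩, hp, rfl⟩
    exact ⟨b, ⟨fitzpatrick_ne_bot hne b,
      ne_top_of_le_ne_top (EReal.coe_ne_top r) (fitzpatrick_le_iff.2 hp)⟩, rfl⟩

theorem IsQuasidense.graph_nonempty (hq : IsQuasidense S) : (graph S).Nonempty := by
  obtain ⟨a, ha, -⟩ := isQuasidense_iff.1 hq 0 1 one_pos
  exact ⟨a, ha⟩

theorem qL_le_rL (b : E × StrongDual ℝ E) : qL b ≤ rL b := by
  rw [rL]; nlinarith [sq_nonneg ‖b.1‖, sq_nonneg ‖b.2‖]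

/-- Each `a` in the graph gives `φ_S(p) ≥ qL p - qL (a - p)`, and quasidensity makes `qL (a - p) ≤
rL (a - p)` arbitrarily small. -/
theorem qL_le_of_mem_fitzEpi (hq : IsQuasidense S) {p : (E × StrongDual ℝ E) × ℝ}
    (hp : p ∈ fitzEpi S) : qL p.1 ≤ p.2 := by
  refine le_of_forall_pos_le_add fun ε hε => ?_
  obtain ⟨a, ha, hle⟩ := isQuasidense_iff.1 hq p.1 ε hε
  have h1 := hp a ha
  have h2 := (qL_le_rL _).trans hle
  rw [qL_sub] at h2
  simp only [qL] at h2 ⊢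
  linarith

theorem mem_fitzEpi_of_mem_graph (hm : IsMonotone S) {a : E × StrongDual ℝ E}
    (ha : a ∈ graph S) : (a, qL a) ∈ fitzEpi S := by
  intro b hb
  have := hm a ha b hb
  rw [qL_sub] at this
  simp only [qL] at this ⊢
  linarith

/-- The conjugate of the Fitzpatrick function of a quasidense monotone multifunction dominates the
duality pairing on `E* × E**`. -/
theorem le_of_conjLE_fitzEpi (hq : IsQuasidense S) (hm : IsMonotone S) {y : StrongDual ℝ E}
    {z : StrongDual ℝ (StrongDual ℝ E)} {M : ℝ} (h : ConjLE (fitzEpi S) y z M) : z y ≤ M := by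
  refine le_of_forall_pos_le_add fun ε hε => ?_
  obtain ⟨v, hv⟩ := exists_half_sq_norm_sub_le z (half_pos hε)
  -- The shift `v`, nearly attaining the conjugate of `½‖·‖²` at `z`, stands in for the bidual
  -- element: it supplies the `½‖z‖² + ½‖v‖²` that absorbs the cross terms.
  obtain ⟨a, ha, hle⟩ := isQuasidense_iff.1 hq (0, y + v) (ε / 2) (half_pos hε)
  have h1 := h _ (mem_fitzEpi_of_mem_graph hm ha)
  have h2 := (abs_le.1 (v.le_opNorm a.1)).2
  have h3 := (abs_le.1 (z.le_opNorm (a.2 - (y + v)))).1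
  simp only [rL, qL, Prod.fst_sub, Prod.snd_sub, sub_zero, sub_apply, add_apply] at hle
  simp only [map_sub, map_add] at h3
  simp only [qL] at h1
  nlinarith [sq_nonneg (‖a.1‖ - ‖v‖), sq_nonneg (‖a.2 - (y + v)‖ - ‖z‖)]

theorem mem_fitzpatrickExt_iff (hq : IsQuasidense S) (hm : IsMonotone S) {y : StrongDual ℝ E}
    {z : StrongDual ℝ (StrongDual ℝ E)} :
    z ∈ fitzpatrickExt S y ↔ ConjLE (fitzEpi S) y z (z y) := by
  rw [← conjugate_fitzpatrick_le_iff hq.graph_nonempty]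
  refine ⟨fun h => le_of_eq h, fun h => le_antisymm h ?_⟩
  by_contra hcon
  obtain ⟨M, hM, hlt⟩ := EReal.lt_iff_exists_real_btwn.1 (not_le.1 hcon)
  have := le_of_conjLE_fitzEpi hq hm ((conjugate_fitzpatrick_le_iff hq.graph_nonempty).1 hM.le)
  exact absurd this (not_le.2 (by exact_mod_cast hlt))

/-- A closed quasidense monotone multifunction is maximally monotone. -/
theorem mem_graph_of_forall_qL_nonneg (hc : IsClosedGraph S) (hq : IsQuasidense S)
    {b : E × StrongDual ℝ E} (hb : ∀ a ∈ graph S, 0 ≤ qL (a - b)) : b ∈ graph S := by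
  rw [← hc.closure_eq, Metric.mem_closure_iff]
  intro ε hε
  obtain ⟨a, ha, hle⟩ := isQuasidense_iff.1 hq b (ε ^ 2 / 4) (by positivity)
  refine ⟨a, ha, ?_⟩
  have h1 := hb a ha
  have h2 := half_sq_norm_le (a - b)
  rw [rL] at hle
  rw [dist_comm, dist_eq_norm]
  refine lt_of_pow_lt_pow_left₀ 2 hε.le ?_
  nlinarith [pow_pos hε 2]

/-- Testing the conjugate at points `(a, qL a)` of the graph shows that `(x, y)` is monotonically
related to `S`, so maximality applies. -/
theorem inclusionInDoubleDual_mem_fitzpatrickExt_iff (hc : IsClosedGraph S) (hq : IsQuasidense S)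
    (hm : IsMonotone S) {x : E} {y : StrongDual ℝ E} :
    NormedSpace.inclusionInDoubleDual ℝ E x ∈ fitzpatrickExt S y ↔ y ∈ S x := by
  rw [mem_fitzpatrickExt_iff hq hm]
  constructor
  · intro h
    refine mem_graph_of_forall_qL_nonneg (b := (x, y)) hc hq fun a ha => ?_
    have := h _ (mem_fitzEpi_of_mem_graph hm ha)
    rw [qL_sub]
    simp only [NormedSpace.dual_def, qL] at this ⊢
    linarith
  · intro h p hp
    have := hp (x, y) h
    simp only [NormedSpace.dual_def] at this ⊢
    linarith

/-! ### Convolution of two Fitzpatrick functions. -/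

theorem conjLE_episum_of_conjLE {A A' : Set ((E × StrongDual ℝ E) × ℝ)} {y : StrongDual ℝ E}
    {z z' : StrongDual ℝ (StrongDual ℝ E)} {M M' : ℝ} (h : ConjLE A y z M)
    (h' : ConjLE A' y z' M') : ConjLE (episum A A') y (z + z') (M + M') := by
  rintro ⟨⟨_, w⟩, _⟩ ⟨x, u, r, s, hx, hu, he⟩
  simp only [Prod.mk.injEq, and_true] at he
  obtain ⟨rfl, rfl⟩ := he
  have h1 := h _ hx
  have h2 := h' _ hu
  simp only [map_add, add_apply] at h1 h2 ⊢
  linarith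

theorem qL_le_of_mem_episum {A A' : Set ((E × StrongDual ℝ E) × ℝ)}
    (hA : ∀ p ∈ A, qL p.1 ≤ p.2) (hA' : ∀ p ∈ A', qL p.1 ≤ p.2) :
    ∀ p ∈ episum A A', qL p.1 ≤ p.2 := by
  rintro ⟨⟨_, w⟩, _⟩ ⟨x, u, r, s, hx, hu, he⟩
  simp only [Prod.mk.injEq, and_true] at he
  obtain ⟨rfl, rfl⟩ := he
  have h1 := hA _ hx
  have h2 := hA' _ hu
  simp only [qL, map_add] at h1 h2 ⊢
  linarith

/-- Attouch–Brezis bounds the sum of the two conjugates; since each dominates the pairing, either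
one can be bounded alone. For `M = z y` both bounds become the equalities defining the Fitzpatrick
extensions. -/
theorem exists_fitzEpi_conj_split [CompleteSpace E] (hSq : IsQuasidense S)
    (hSm : IsMonotone S) (hTq : IsQuasidense T) (hTm : IsMonotone T)
    (hcone : IsClosedSubspace (coneDiff (Prod.snd '' effDom (fitzpatrick S))
      (Prod.snd '' effDom (fitzpatrick T))))
    {y : StrongDual ℝ E} {z : StrongDual ℝ (StrongDual ℝ E)} {M : ℝ}
    (hM : ConjLE (episum (fitzEpi S) (fitzEpi T)) y z M) :
    ∃ ζ : StrongDual ℝ (StrongDual ℝ E), ConjLE (fitzEpi S) y (z - ζ) (M - ζ y) ∧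
      ConjLE (fitzEpi T) y ζ (M - (z - ζ) y) := by
  rw [snd_image_effDom_fitzpatrick hSq.graph_nonempty,
    snd_image_effDom_fitzpatrick hTq.graph_nonempty] at hcone
  obtain ⟨ζ, hζ⟩ := exists_conj_split_of_conjLE_episum convex_fitzEpi convex_fitzEpi
    isClosed_fitzEpi isClosed_fitzEpi hcone hM
  refine ⟨ζ, fun p hp => ?_, fun p' hp' => ?_⟩
  · have := le_of_conjLE_fitzEpi hTq hTm (y := y) (z := ζ)
      (M := M - (y p.1.1 + (z - ζ) p.1.2 - p.2)) (fun p' hp' => by linarith [hζ p hp p' hp'])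
    linarith
  · have := le_of_conjLE_fitzEpi hSq hSm (y := y) (z := z - ζ)
      (M := M - (y p'.1.1 + ζ p'.1.2 - p'.2)) (fun p hp => by linarith [hζ p hp p' hp'])
    linarith

theorem le_of_conjLE_episum_fitzEpi [CompleteSpace E] (hSq : IsQuasidense S)
    (hSm : IsMonotone S) (hTq : IsQuasidense T) (hTm : IsMonotone T)
    (hcone : IsClosedSubspace (coneDiff (Prod.snd '' effDom (fitzpatrick S))
      (Prod.snd '' effDom (fitzpatrick T))))
    (y : StrongDual ℝ E) (z : StrongDual ℝ (StrongDual ℝ E))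
    (M : ℝ) (hM : ConjLE (episum (fitzEpi S) (fitzEpi T)) y z M) : z y ≤ M := by
  obtain ⟨ζ, h, -⟩ := exists_fitzEpi_conj_split hSq hSm hTq hTm hcone hM
  have := le_of_conjLE_fitzEpi hSq hSm h
  rw [sub_apply] at this
  linarith

theorem fitzpatrickParallelSum_eq_conjCoincidence [CompleteSpace E] (hSq : IsQuasidense S)
    (hSm : IsMonotone S) (hTq : IsQuasidense T) (hTm : IsMonotone T)
    (hcone : IsClosedSubspace (coneDiff (Prod.snd '' effDom (fitzpatrick S))
      (Prod.snd '' effDom (fitzpatrick T)))) :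
    fitzpatrickParallelSum S T = conjCoincidence (episum (fitzEpi S) (fitzEpi T)) := by
  funext x
  ext y
  constructor
  · intro h
    obtain ⟨z, hz, z', hz', hzz⟩ := Set.mem_add.1 h
    have := conjLE_episum_of_conjLE ((mem_fitzpatrickExt_iff hSq hSm).1 hz)
      ((mem_fitzpatrickExt_iff hTq hTm).1 hz')
    rw [← add_apply, hzz, NormedSpace.dual_def] at this
    exact this
  · intro h
    obtain ⟨ζ, h1, h2⟩ := exists_fitzEpi_conj_split hSq hSm hTq hTm hcone h
    have hxy : y x = NormedSpace.inclusionInDoubleDual ℝ E x y := rfl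
    rw [hxy] at h1 h2
    refine Set.mem_add.2 ⟨NormedSpace.inclusionInDoubleDual ℝ E x - ζ,
      (mem_fitzpatrickExt_iff hSq hSm).2 (by rwa [sub_apply]), ζ,
      (mem_fitzpatrickExt_iff hTq hTm).2 ?_, by abel⟩
    rwa [sub_apply, sub_sub_cancel] at h2

/-! ### Range conditions and the parallel sum. -/

theorem coneDiff_mono {X : Type*} [AddCommGroup X] [Module ℝ X] {A A' B B' : Set X}
    (hA : A ⊆ A') (hB : B ⊆ B') : coneDiff A B ⊆ coneDiff A' B' :=
  Set.iUnion₂_mono fun _ _ => Set.smul_set_mono (Set.sub_subset_sub hA hB)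

theorem exists_pos_add_smul_mem {X : Type*} [AddCommGroup X] [Module ℝ X] [TopologicalSpace X]
    [ContinuousAdd X] [ContinuousSMul ℝ X] {A : Set X} {a : X} (ha : a ∈ interior A) (v : X) :
    ∃ t : ℝ, 0 < t ∧ a + t • v ∈ A := by
  have hlim : Tendsto (fun t : ℝ => a + t • v) (𝓝[>] 0) (𝓝 a) := by
    have : Continuous fun t : ℝ => a + t • v := by fun_prop
    have := this.tendsto 0
    rw [zero_smul, add_zero] at this
    exact this.mono_left nhdsWithin_le_nhds
  obtain ⟨t, h, ht⟩ := ((hlim.eventually (mem_interior_iff_mem_nhds.1 ha)).and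
    self_mem_nhdsWithin).exists
  exact ⟨t, ht, h⟩

theorem coneDiff_eq_univ {X : Type*} [AddCommGroup X] [Module ℝ X] [TopologicalSpace X]
    [ContinuousAdd X] [ContinuousSMul ℝ X] {A B : Set X}
    (h : (A ∩ interior B).Nonempty ∨ (interior A ∩ B).Nonempty) : coneDiff A B = Set.univ := by
  refine Set.eq_univ_of_forall fun v => ?_
  simp only [coneDiff, Set.mem_iUnion]
  rcases h with ⟨a, haA, haB⟩ | ⟨a, haA, haB⟩
  · obtain ⟨t, ht, hmem⟩ := exists_pos_add_smul_mem haB (-v)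
    refine ⟨t⁻¹, inv_pos.2 ht, Set.mem_smul_set.2 ⟨_, Set.sub_mem_sub haA hmem, ?_⟩⟩
    rw [sub_add_cancel_left, smul_neg, inv_smul_smul₀ ht.ne', neg_neg]
  · obtain ⟨t, ht, hmem⟩ := exists_pos_add_smul_mem haA v
    refine ⟨t⁻¹, inv_pos.2 ht, Set.mem_smul_set.2 ⟨_, Set.sub_mem_sub hmem haB, ?_⟩⟩
    rw [add_sub_cancel_left, inv_smul_smul₀ ht.ne']

theorem range_subset_snd_image_effDom (hm : IsMonotone S) :
    range S ⊆ Prod.snd '' effDom (fitzpatrick S) := by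
  intro y hy
  obtain ⟨x, hx⟩ := Set.mem_iUnion.1 hy
  have hg : (x, y) ∈ graph S := hx
  rw [snd_image_effDom_fitzpatrick ⟨_, hg⟩]
  exact ⟨_, mem_fitzEpi_of_mem_graph hm hg, rfl⟩

/-- If a canonical image splits and the summand from `T^𝔽` is canonical, so is the other; on
canonical images the extensions are just the inverses of `S` and `T`. -/
theorem parallelSum_eq_fitzpatrickParallelSum (hSc : IsClosedGraph S) (hSq : IsQuasidense S)
    (hSm : IsMonotone S) (hTc : IsClosedGraph T) (hTq : IsQuasidense T) (hTm : IsMonotone T)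
    (hR : range (fitzpatrickExt T) ⊆ Set.range (NormedSpace.inclusionInDoubleDual ℝ E)) :
    parallelSum S T = fitzpatrickParallelSum S T := by
  funext x
  ext y
  constructor
  · intro h
    obtain ⟨s, hs, t, ht, hst⟩ := Set.mem_add.1 h
    exact Set.mem_add.2 ⟨_, (inclusionInDoubleDual_mem_fitzpatrickExt_iff hSc hSq hSm).2 hs, _,
      (inclusionInDoubleDual_mem_fitzpatrickExt_iff hTc hTq hTm).2 ht, by rw [← map_add, hst]⟩
  · intro h
    obtain ⟨z, hz, z', hz', hzz⟩ := Set.mem_add.1 h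
    obtain ⟨t, rfl⟩ := hR (Set.mem_iUnion.2 ⟨y, hz'⟩)
    obtain rfl : z = NormedSpace.inclusionInDoubleDual ℝ E (x - t) := by
      rw [map_sub, ← hzz, add_sub_cancel_right]
    exact Set.mem_add.2 ⟨_, (inclusionInDoubleDual_mem_fitzpatrickExt_iff hSc hSq hSm).1 hz, _,
      (inclusionInDoubleDual_mem_fitzpatrickExt_iff hTc hTq hTm).1 hz', sub_add_cancel _ _⟩

end MonotoneSum

end

theorem theorem9p1 {E : Type*} [NormedAddCommGroup E] [NormedSpace ℝ E] [CompleteSpace E]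
    (S T : E → Set (StrongDual ℝ E))
    (hSc : MonotoneSum.IsClosedGraph S) (hSq : MonotoneSum.IsQuasidense S)
    (hSm : MonotoneSum.IsMonotone S)
    (hTc : MonotoneSum.IsClosedGraph T) (hTq : MonotoneSum.IsQuasidense T)
    (hTm : MonotoneSum.IsMonotone T) :
    -- (a) implies (b)
    (((MonotoneSum.range S ∩ interior (MonotoneSum.range T)).Nonempty ∨
        (interior (MonotoneSum.range S) ∩ MonotoneSum.range T).Nonempty) →
      MonotoneSum.coneDiff (MonotoneSum.range S) (MonotoneSum.range T) = Set.univ) ∧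
    -- (b) implies (c)
    (MonotoneSum.coneDiff (MonotoneSum.range S) (MonotoneSum.range T) = Set.univ →
      MonotoneSum.IsClosedSubspace (MonotoneSum.coneDiff
        (Prod.snd '' MonotoneSum.effDom (MonotoneSum.fitzpatrick S))
        (Prod.snd '' MonotoneSum.effDom (MonotoneSum.fitzpatrick T)))) ∧
    -- (c) implies (d)
    (MonotoneSum.IsClosedSubspace (MonotoneSum.coneDiff
        (Prod.snd '' MonotoneSum.effDom (MonotoneSum.fitzpatrick S))
        (Prod.snd '' MonotoneSum.effDom (MonotoneSum.fitzpatrick T))) →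
      MonotoneSum.IsClosedGraph (MonotoneSum.fitzpatrickParallelSum S T) ∧
      MonotoneSum.IsQuasidense (MonotoneSum.fitzpatrickParallelSum S T) ∧
      MonotoneSum.IsMonotone (MonotoneSum.fitzpatrickParallelSum S T)) ∧
    -- (d) and the range condition on the Fitzpatrick extension of `T` imply (e)
    ((MonotoneSum.IsClosedGraph (MonotoneSum.fitzpatrickParallelSum S T) ∧
        MonotoneSum.IsQuasidense (MonotoneSum.fitzpatrickParallelSum S T) ∧
        MonotoneSum.IsMonotone (MonotoneSum.fitzpatrickParallelSum S T)) →
      MonotoneSum.range (MonotoneSum.fitzpatrickExt T) ⊆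
        Set.range (NormedSpace.inclusionInDoubleDual ℝ E) →
      MonotoneSum.IsClosedGraph (MonotoneSum.parallelSum S T) ∧
      MonotoneSum.IsMonotone (MonotoneSum.parallelSum S T) ∧
      MonotoneSum.IsQuasidense (MonotoneSum.parallelSum S T)) := by
  refine ⟨MonotoneSum.coneDiff_eq_univ, fun h => ?_, fun h => ?_, fun h hR => ?_⟩
  · have huniv := Set.eq_univ_of_univ_subset (h.symm.subset.trans (MonotoneSum.coneDiff_mono
      (MonotoneSum.range_subset_snd_image_effDom hSm)
      (MonotoneSum.range_subset_snd_image_effDom hTm)))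
    rw [huniv]
    exact ⟨isClosed_univ, ⊤, Submodule.top_coe⟩
  · have hconj := MonotoneSum.le_of_conjLE_episum_fitzEpi hSq hSm hTq hTm h
    rw [MonotoneSum.fitzpatrickParallelSum_eq_conjCoincidence hSq hSm hTq hTm h]
    exact ⟨MonotoneSum.isClosedGraph_conjCoincidence,
      MonotoneSum.isQuasidense_conjCoincidence
        (MonotoneSum.convex_episum MonotoneSum.convex_fitzEpi MonotoneSum.convex_fitzEpi)
        (MonotoneSum.qL_le_of_mem_episum (fun _ => MonotoneSum.qL_le_of_mem_fitzEpi hSq)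
          (fun _ => MonotoneSum.qL_le_of_mem_fitzEpi hTq)) hconj,
      MonotoneSum.isMonotone_conjCoincidence hconj⟩
  · rw [MonotoneSum.parallelSum_eq_fitzpatrickParallelSum hSc hSq hSm hTc hTq hTm hR]
    exact ⟨h.1, h.2.2, h.2.1⟩
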